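/- **Definitions.** A natural transformation between endofunctors of $Set$ is *weakly cartesian* if all its naturality squares are weak pullbacks. An *analytic monad* is a monad $\mathcal A=(\mathcal A,\eta,\mu)$ on $Set$ with $\eta,\mu$ weakly cartesian, together with left $S_n$-sets $A_n$ ($n\in\omega$) and a natural isomorphism $\mathcal A(X)\cong\sum_{n\in\omega}X^n\otimes_n A_n$, where $X^n\otimes_nA_n$ is the quotient of $X^n\times A_n$ by $(x\circ\sigma,a)\sim(x,\sigma a)$, $\sigma\in S_n$; the class of $(x,a)$ is written $[x,a]$. A lax morphism of monads $\tau:\mathcal A\to\mathcal A'$ (over the identity functor of $Set$) is a natural transformation compatible with units and multiplications; it induces $\mathcal{EM}(\tau):\mathcal{EM}(\mathcal A')\to\mathcal{EM}(\mathcal A)$, $(B,\beta)\mapsto(B,\beta\circ\tau_B)$. For a commutative monoid $Z$ (i.e. an algebra for the terminal analytic monad), the *category of linear polynomials* $CP_l(Z)$ has as objects the elements of $Z$, and as morphisms the classes $[z,i]:z_i\to\prod_{j=1}^n z_j$ of pairs of a tuple $z\in Z^n$ and an index $i\in\{1,\dots,n\}$, modulo permutations of $\{1,\dots,n\}$. The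 identity of $x$ is $[(x),1]$, and $[z',j]\circ[z,i]$ (where $\prod z=z'_j$) is obtained by replacing the entry $z'_j$ of $z'$ by the whole tuple $z$, with the entry $z_i$ distinguished. For a functor $F:CP_l(Z)\to\mathcal{EM}(\mathcal A)$ with $F(b)=(F(b),\xi_b)$, the *Płonka sum* $\bigsqcup_ZF$ is the set $\coprod_{b\in Z}F(b)$ with the structure map $$\mathcal A\Big(\coprod_{b}F(b)\Big)\xrightarrow{\ \lambda_F\ }\coprod_{b}\mathcal A(F(b))\xrightarrow{\ \coprod_b\xi_b\ }\coprod_{b}F(b),$$ where, for $x=((z_1,y_1),\dots,(z_n,y_n))$ with $y_i\in F(z_i)$ and $a\in A_n$, the element $\lambda_F([x,a])$ is $[(F([z,1])(y_1),\dots,F([z,n])(y_n)),a]\in\mathcal A(F(b))$ with $b=z_1\cdots z_n$. **Theorem.** Let $\tau:\mathcal A\to\mathcal A'$ be an arbitrary lax morphism of monads between analytic monads. Then $\tau$ is weakly cartesian if and only if $\mathcal{EM}(\tau)$ preserves Płonka sums, i.e. for every commutative monoid $Z$ and every functor $F:CP_l(Z)\to\mathcal{EM}(\mathcal A')$ the two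 $\mathcal A$-structure maps on the set $\coprod_{b\in Z}F(b)$ coincide: the structure map of $\bigsqcup_ZF$ composed with $\tau_{\coprod_b F(b)}$, and the structure map of $\bigsqcup_Z(\mathcal{EM}(\tau)\circ F)$. Moreover, it is enough to require this when both Płonka sums satisfy the axioms of Eilenberg–Moore algebras: $\tau$ is weakly cartesian if and only if $\mathcal{EM}(\tau)(\bigsqcup_ZF)=\bigsqcup_Z(\mathcal{EM}(\tau)\circ F)$ for all $Z$ and all $F$ for which $\bigsqcup_ZF$ and $\bigsqcup_Z(\mathcal{EM}(\tau)\circ F)$ are Eilenberg–Moore algebras. -/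

import Mathlib

open CategoryTheory CategoryTheory.Limits

universe u

namespace Plonka

/-! ### Weakly cartesian transformations and analytic functors -/

/-- A natural transformation is weakly cartesian if all its naturality squares are weak
pullbacks. -/
def WeaklyCartesian {F G : Type u ⥤ Type u} (α : F ⟶ G) : Prop :=
  ∀ ⦃X Y : Type u⦄ (f : X ⟶ Y),
    Nonempty (IsWeakLimit (PullbackCone.mk (F.map f) (α.app X) (α.naturality f)))

/-- A functor from the groupoid of finite sets `{1, …, n}` and bijections to sets:
a family of sets `A n` with left actions of the symmetric groups. -/
structure SymmetricSequence where
  obj : ℕ → Type u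
  action : ∀ n, MulAction (Equiv.Perm (Fin n)) (obj n)

attribute [instance] SymmetricSequence.action

namespace SymmetricSequence

variable (A : SymmetricSequence.{u})

/-- The identifications `(x ∘ σ, a) ∼ (x, σ • a)` on `X ^ n × A n`. -/
def tensorSetoid (n : ℕ) (X : Type u) : Setoid ((Fin n → X) × A.obj n) where
  r p q := ∃ σ : Equiv.Perm (Fin n), p.1 = q.1 ∘ σ ∧ q.2 = σ • p.2
  iseqv :=
    { refl := fun p => ⟨1, by simp, by simp⟩
      symm := by
        rintro ⟨x, a⟩ ⟨y, b⟩ ⟨σ, h₁, h₂⟩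
        refine ⟨σ⁻¹, ?_, ?_⟩
        · funext i; simp_all
        · simp_all
      trans := by
        rintro ⟨x, a⟩ ⟨y, b⟩ ⟨z, c⟩ ⟨σ, h₁, h₂⟩ ⟨τ, h₃, h₄⟩
        refine ⟨τ * σ, ?_, ?_⟩
        · funext i; simp_all
        · simp_all [mul_smul] }

/-- The set `X ^ n ⊗ₙ A n`. -/
def Tensor (n : ℕ) (X : Type u) : Type u := Quotient (A.tensorSetoid n X)

/-- The analytic functor `X ↦ ∑ₙ X ^ n ⊗ₙ A n`. -/
def series : Type u ⥤ Type u where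
  obj X := Σ n : ℕ, A.Tensor n X
  map {X Y} f := ↾fun t => ⟨t.1, Quotient.map (fun p => (f ∘ p.1, p.2))
    (by
      rintro ⟨x, a⟩ ⟨y, b⟩ ⟨σ, h₁, h₂⟩
      exact ⟨σ, by simp_all [Function.comp_assoc], h₂⟩) t.2⟩
  map_id X := by
    apply ConcreteCategory.hom_ext
    rintro ⟨n, q⟩
    induction q using Quotient.inductionOn
    rfl
  map_comp f g := by
    apply ConcreteCategory.hom_ext
    rintro ⟨n, q⟩
    induction q using Quotient.inductionOn
    rfl

end SymmetricSequence

/-- An analytic monad on the category of sets: a monad whose functor part has an expansion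
`X ↦ ∑ₙ X ^ n ⊗ₙ A n`, and whose unit and multiplication are weakly cartesian. -/
structure AnalyticMonad where
  toMonad : Monad (Type u)
  coeff : SymmetricSequence.{u}
  expansion : toMonad.toFunctor ≅ coeff.series
  weaklyCartesian_η : WeaklyCartesian toMonad.η
  weaklyCartesian_μ : WeaklyCartesian toMonad.μ

namespace AnalyticMonad

variable (𝒜 : AnalyticMonad.{u}) {X Y : Type u} {n m : ℕ}

/-- The element `[x, a]` of `𝒜(X)` for `x ∈ X ^ n` and `a ∈ A n`. -/
def elt (x : Fin n → X) (a : 𝒜.coeff.obj n) : 𝒜.toMonad.obj X :=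
  𝒜.expansion.inv.app X ⟨n, Quotient.mk _ (x, a)⟩

variable {𝒜}

theorem expansion_elt (x : Fin n → X) (a : 𝒜.coeff.obj n) :
    𝒜.expansion.hom.app X (𝒜.elt x a) = ⟨n, Quotient.mk _ (x, a)⟩ :=
  ConcreteCategory.congr_hom (𝒜.expansion.inv_hom_id_app X) _

theorem elt_perm (x : Fin n → X) (a : 𝒜.coeff.obj n) (σ : Equiv.Perm (Fin n)) :
    𝒜.elt (x ∘ σ) a = 𝒜.elt x (σ • a) := by
  have : (Quotient.mk (𝒜.coeff.tensorSetoid n X) (x ∘ σ, a)) = Quotient.mk _ (x, σ • a) :=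
    Quotient.sound ⟨σ, rfl, rfl⟩
  unfold elt
  rw [this]

end AnalyticMonad

/-! ### Linear polynomials over a commutative monoid -/

/-- The objects of the category of linear polynomials over `Z`: the elements of `Z`. -/
def LinPoly (Z : Type u) : Type u := Z

namespace LinPoly

variable {Z : Type u} [CommMonoid Z]

instance : CommMonoid (LinPoly Z) := inferInstanceAs (CommMonoid Z)

/-- A linear-regular term over commutative monoids in `n` variables is the product
`x₁ ⋯ xₙ`. So a linear polynomial `[z, i]` is a tuple `z ∈ Z ^ n` with a distinguished index `i`,
up to permutations, i.e. a finite multiset with a distinguished member. It is a morphism from the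
distinguished member `z i` to the value `∏ z`, and is represented here by the multiset of all the
other members. -/
@[ext]
structure Hom (x y : LinPoly Z) : Type u where
  others : Multiset (LinPoly Z)
  mul_prod : x * others.prod = y

/-- The identity is `[x, 1]` for the one-term tuple `x`. The composite of `[z, i]` and `[z', j]`
substitutes the tuple `z` for the member `z' j` of `z'`. -/
instance : SmallCategory (LinPoly Z) where
  Hom := Hom
  id x := ⟨0, by simp⟩
  comp f g := ⟨f.others + g.others, by rw [Multiset.prod_add, ← mul_assoc, f.mul_prod, g.mul_prod]⟩
  id_comp f := Hom.ext (zero_add f.others)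
  comp_id f := Hom.ext (add_zero f.others)
  assoc f g h := Hom.ext (add_assoc f.others g.others h.others)

/-- The linear polynomial `[z, i] : z i ⟶ ∏ z`. -/
def poly {ι : Type} [Fintype ι] [DecidableEq ι] (z : ι → LinPoly Z) (i : ι) {y : LinPoly Z}
    (h : ∏ j, z j = y) : z i ⟶ y :=
  ⟨(Finset.univ.erase i).val.map z, by
    rw [← h]; exact Finset.mul_prod_erase _ z (Finset.mem_univ i)⟩

theorem hom_ext {x y : LinPoly Z} {f g : x ⟶ y} (h : f.others = g.others) : f = g := Hom.ext h

theorem poly_val_equiv {ι κ : Type} [Fintype ι] [DecidableEq ι] [Fintype κ] [DecidableEq κ]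
    (σ : ι ≃ κ) (z : κ → LinPoly Z) (i : ι) :
    (poly (z ∘ σ) i rfl).others = (poly z (σ i) rfl).others := by
  change Multiset.map _ _ = Multiset.map _ _
  rw [← Multiset.map_map]
  congr 1
  have : Finset.univ.erase (σ i) = (Finset.univ.erase i).map σ.toEmbedding := by
    rw [Finset.map_erase, Finset.map_univ_equiv]; rfl
  rw [this]; rfl

/-- Every morphism is of the form `[z, i]`. -/
theorem exists_poly {x y : LinPoly Z} (f : x ⟶ y) :
    ∃ (n : ℕ) (z : Fin n → LinPoly Z) (i : Fin n) (_ : z i = x) (h : ∏ j, z j = y),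
      f.others = (poly z i h).others := by
  obtain ⟨m, hm⟩ := f
  obtain ⟨l, rfl⟩ := Quot.exists_rep m
  have h₁ : Finset.univ.erase (0 : Fin (l.length + 1)) = Finset.univ.map (Fin.succEmb _) := by
    ext j; simp [Fin.exists_succ_eq]
  have key : (Finset.univ.erase (0 : Fin (l.length + 1))).val.map
      (Fin.cons x l.get : Fin (l.length + 1) → LinPoly Z) = (l : Multiset (LinPoly Z)) := by
    rw [h₁, Finset.map_val, Multiset.map_map]
    change Multiset.map l.get _ = _
    rw [Fin.univ_val_map, List.ofFn_get]
  refine ⟨l.length + 1, Fin.cons x l.get, 0, rfl, ?_, key.symm⟩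
  rw [← Finset.mul_prod_erase _ _ (Finset.mem_univ (0 : Fin (l.length + 1)))]
  refine Eq.trans ?_ hm
  exact congrArg (fun t => x * Multiset.prod t) key

/-- Two pairs `(z, i)`, `(z', i')` name the same morphism iff they agree up to a permutation. -/
theorem poly_eq_iff {n m : ℕ} (z : Fin n → LinPoly Z) (i : Fin n) (z' : Fin m → LinPoly Z)
    (i' : Fin m) (h₀ : z i = z' i') :
    (poly z i rfl).others = (poly z' i' rfl).others ↔ ∃ σ : Fin n ≃ Fin m, z = z' ∘ σ ∧ σ i = i' := by
  classical
  constructor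
  · intro h
    have hz : ∀ {k : ℕ} (w : Fin k → LinPoly Z) (j : Fin k),
        Finset.univ.val.map w = w j ::ₘ (poly w j rfl).others := by
      intro k w j
      change _ = w j ::ₘ (Finset.univ.erase j).val.map w
      rw [← Multiset.map_cons, ← Finset.insert_val_of_notMem (Finset.notMem_erase j _),
        Finset.insert_erase (Finset.mem_univ j)]
    have hall : Finset.univ.val.map z = Finset.univ.val.map z' := by
      rw [hz z i, hz z' i', h, h₀]
    have hc : ∀ {k : ℕ} (w : Fin k → LinPoly Z) (c : LinPoly Z),
        Fintype.card {j // w j = c} = (Finset.univ.val.map w).count c := by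
      intro k w c
      rw [Multiset.count_map, Fintype.card_subtype, Finset.card_def, Finset.filter_val]
      simp only [eq_comm]
    let e : ∀ c, {j // z j = c} ≃ {j // z' j = c} := fun c =>
      Fintype.equivOfCardEq (by rw [hc, hc, hall])
    let τ : Fin n ≃ Fin m :=
      (Equiv.sigmaFiberEquiv z).symm.trans
        ((Equiv.sigmaCongrRight e).trans (Equiv.sigmaFiberEquiv z'))
    have hτ : ∀ j, z' (τ j) = z j := fun j => (e (z j) ⟨j, rfl⟩).2
    refine ⟨τ.trans (Equiv.swap (τ i) i'), ?_, by simp⟩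
    funext j
    simp only [Function.comp_apply, Equiv.trans_apply]
    rw [← hτ j]
    have : z' (τ i) = z' i' := by rw [hτ, h₀]
    rcases eq_or_ne (τ j) (τ i) with hj | hj
    · rw [hj, Equiv.swap_apply_left, this]
    · rcases eq_or_ne (τ j) i' with hj' | hj'
      · rw [hj', Equiv.swap_apply_right, this]
      · rw [Equiv.swap_apply_of_ne_of_ne hj hj']
  · rintro ⟨σ, rfl, rfl⟩
    exact (poly_val_equiv σ z' i).symm ▸ rfl

/-- The composite of `[z, i]` and `[z', j]` is given by substituting `z` for `z' j`. -/
theorem poly_comp_poly {ι κ : Type} [Fintype ι] [DecidableEq ι] [Fintype κ] [DecidableEq κ]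
    (z : ι → LinPoly Z) (i : ι) (z' : κ → LinPoly Z) (j : κ) {y : LinPoly Z}
    (h : ∏ k, z k = z' j) (h' : ∏ k, z' k = y) :
    ∃ h'', poly z i h ≫ poly z' j h' =
      poly (Sum.elim z (fun k : {k // k ≠ j} => z' k)) (Sum.inl i) h'' := by
  have h₁ : (Finset.univ : Finset {k // k ≠ j}).map (Function.Embedding.subtype _)
      = Finset.univ.erase j := by
    ext k; simp
  have h₂ : (Finset.univ.erase (Sum.inl i : ι ⊕ {k // k ≠ j})) =
      (Finset.univ.erase i).disjSum Finset.univ := by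
    ext (k | k) <;> simp
  have key : (Finset.univ.erase (Sum.inl i : ι ⊕ {k // k ≠ j})).val.map
      (Sum.elim z (fun k : {k // k ≠ j} => z' k)) = (poly z i h ≫ poly z' j h').others := by
    rw [h₂, Finset.val_disjSum, Multiset.disjSum, Multiset.map_add, Multiset.map_map,
      Multiset.map_map]
    change _ = (Finset.univ.erase i).val.map z + (Finset.univ.erase j).val.map z'
    rw [← h₁, Finset.map_val, Multiset.map_map]
    rfl
  have h'' : ∏ k, Sum.elim z (fun k : {k // k ≠ j} => z' k) k = y := by
    rw [← Finset.mul_prod_erase _ _ (Finset.mem_univ (Sum.inl i))]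
    exact (congrArg (fun t => z i * Multiset.prod t) key).trans (poly z i h ≫ poly z' j h').mul_prod
  exact ⟨h'', hom_ext key.symm⟩

end LinPoly

/-! ### Płonka sums -/

section Sums

variable {Z : Type u} [CommMonoid Z]

/-- The coproduct `∐ F(z)` over the objects `z` of the index category. -/
abbrev Coprod (F : LinPoly Z ⥤ Type u) : Type u := Σ z : LinPoly Z, F.obj z

/-- For `x ∈ (∐ F(z)) ^ n` lying over `(z₁, …, zₙ)`, with `z₁ ⋯ zₙ = b`, the tuple in `F(b) ^ n`
with components `F([z, i])(xᵢ)`. -/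
def transport (F : LinPoly Z ⥤ Type u) {n : ℕ} (x : Fin n → Coprod F) {b : LinPoly Z}
    (h : ∏ j, (x j).1 = b) : Fin n → F.obj b :=
  fun i => F.map (LinPoly.poly (fun j => (x j).1) i h) (x i).2

variable (𝒜 : AnalyticMonad.{u})

/-- The transformation `λ : 𝒜(∐ F(z)) ⟶ ∐ 𝒜(F(z))`, sending `[x, a]` to `[x', a] ∈ 𝒜(F(b))`, where
`b` is the product of the tuple underlying `x`, and `x'` is the transport of `x` to `F(b)`. -/
def distrib (F : LinPoly Z ⥤ Type u) :
    𝒜.toMonad.obj (Coprod F) ⟶ Coprod (F ⋙ 𝒜.toMonad.toFunctor) :=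
  𝒜.expansion.hom.app (Coprod F) ≫ ↾fun t => Quotient.lift
    (fun p : (Fin t.1 → Coprod F) × 𝒜.coeff.obj t.1 =>
      (⟨∏ j, (p.1 j).1, 𝒜.elt (transport F p.1 rfl) p.2⟩ :
        Coprod (F ⋙ 𝒜.toMonad.toFunctor)))
    (by
      rintro ⟨x, a⟩ ⟨y, b⟩ ⟨σ, h₁, h₂⟩
      dsimp only at h₁ h₂
      subst h₁ h₂
      have h : ∏ j, ((y ∘ σ) j).1 = ∏ j, (y j).1 := Equiv.prod_comp σ fun j => (y j).1
      have e : transport F (y ∘ σ) h = transport F y rfl ∘ σ := by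
        funext i
        exact ConcreteCategory.congr_hom
          (congrArg F.map (LinPoly.hom_ext (f := LinPoly.poly (fun j => ((y ∘ σ) j).1) i h)
            (g := LinPoly.poly (fun j => (y j).1) (σ i) rfl)
            (LinPoly.poly_val_equiv σ (fun j => (y j).1) i))) _
      have e' : ∀ (b : LinPoly Z) (h' : ∏ j, ((y ∘ σ) j).1 = b),
          (⟨∏ j, ((y ∘ σ) j).1, 𝒜.elt (transport F (y ∘ σ) rfl) a⟩ :
            Coprod (F ⋙ 𝒜.toMonad.toFunctor)) = ⟨b, 𝒜.elt (transport F (y ∘ σ) h') a⟩ := by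
        rintro _ rfl; rfl
      dsimp only
      rw [e' _ h, e, AnalyticMonad.elt_perm]) t.2

theorem distrib_elt (F : LinPoly Z ⥤ Type u) {n : ℕ} (x : Fin n → Coprod F)
    (a : 𝒜.coeff.obj n) :
    distrib 𝒜 F (𝒜.elt x a) = ⟨∏ j, (x j).1, 𝒜.elt (transport F x rfl) a⟩ := by
  simp only [distrib, types_comp_apply, AnalyticMonad.expansion_elt]
  rfl

/-- The structure map `𝒜(∐ F(z)) ⟶ ∐ 𝒜(F(z)) ⟶ ∐ F(z)` of the Płonka sum of a diagram of
`𝒜`-algebras indexed by the category of linear polynomials over `Z`. -/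
def plonkaStr (F : LinPoly Z ⥤ 𝒜.toMonad.Algebra) :
    𝒜.toMonad.obj (Coprod (F ⋙ 𝒜.toMonad.forget)) ⟶ Coprod (F ⋙ 𝒜.toMonad.forget) :=
  distrib 𝒜 (F ⋙ 𝒜.toMonad.forget) ≫ ↾fun t => ⟨t.1, (F.obj t.1).a t.2⟩

theorem plonkaStr_elt (F : LinPoly Z ⥤ 𝒜.toMonad.Algebra) {n : ℕ}
    (x : Fin n → Coprod (F ⋙ 𝒜.toMonad.forget)) (a : 𝒜.coeff.obj n) :
    plonkaStr 𝒜 F (𝒜.elt x a) = ⟨∏ j, (x j).1,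
      (F.obj (∏ j, (x j).1)).a (𝒜.elt (transport (F ⋙ 𝒜.toMonad.forget) x rfl) a)⟩ := by
  rw [plonkaStr, types_comp_apply, distrib_elt]
  rfl

/-- The Płonka sum of `F` satisfies the axioms of an Eilenberg-Moore algebra. This is automatic if
`F([z, i])` depends only on `z i` and on the product of the other members of `z`, but not for all
diagrams `F`. -/
structure HasPlonkaAlgebra (F : LinPoly Z ⥤ 𝒜.toMonad.Algebra) : Prop where
  unit : 𝒜.toMonad.η.app _ ≫ plonkaStr 𝒜 F = 𝟙 (Coprod (F ⋙ 𝒜.toMonad.forget))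
  assoc : 𝒜.toMonad.μ.app _ ≫ plonkaStr 𝒜 F = 𝒜.toMonad.map (plonkaStr 𝒜 F) ≫ plonkaStr 𝒜 F

/-- The Płonka sum as an Eilenberg-Moore algebra. -/
def plonkaAlgebra (F : LinPoly Z ⥤ 𝒜.toMonad.Algebra) (h : HasPlonkaAlgebra 𝒜 F) :
    𝒜.toMonad.Algebra where
  A := Coprod (F ⋙ 𝒜.toMonad.forget)
  a := plonkaStr 𝒜 F
  unit := h.unit
  assoc := h.assoc

end Sums

variable {𝒜 𝒜' : AnalyticMonad.{u}}

/-- The functor `EM(τ) : EM(𝒜') ⥤ EM(𝒜)` preserves Płonka sums: for each diagram `F` of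
`𝒜'`-algebras, the two `𝒜`-structures on the set `∐ F(z)` coincide, the one restricted along `τ`
from the Płonka sum of `F`, and the one of the Płonka sum of `EM(τ) ∘ F`. -/
def PreservesPlonkaSums (τ : 𝒜.toMonad ⟶ 𝒜'.toMonad) : Prop :=
  ∀ (Z : Type u) [CommMonoid Z] (F : LinPoly Z ⥤ 𝒜'.toMonad.Algebra),
    τ.app (Coprod (F ⋙ 𝒜'.toMonad.forget)) ≫ plonkaStr 𝒜' F =
      plonkaStr 𝒜 (F ⋙ Monad.algebraFunctorOfMonadHom τ)

/-- The same for those diagrams whose Płonka sums are Eilenberg-Moore algebras, as an equality of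
algebras. -/
def PreservesPlonkaAlgebras (τ : 𝒜.toMonad ⟶ 𝒜'.toMonad) : Prop :=
  ∀ (Z : Type u) [CommMonoid Z] (F : LinPoly Z ⥤ 𝒜'.toMonad.Algebra)
    (h' : HasPlonkaAlgebra 𝒜' F)
    (h : HasPlonkaAlgebra 𝒜 (F ⋙ Monad.algebraFunctorOfMonadHom τ)),
    (Monad.algebraFunctorOfMonadHom τ).obj (plonkaAlgebra 𝒜' F h') =
      plonkaAlgebra 𝒜 (F ⋙ Monad.algebraFunctorOfMonadHom τ) h

end Plonka

namespace Plonka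

/-! ### Multisets as images of finite families -/

section Multisets

open Finset (univ)

/-! Sending `[x, a]` to the multiset of entries of `x` is a weakly cartesian transformation `supp`
from an analytic functor to the finite multiset functor, and `IsSupport.unique` says that a functor
has at most one such transformation. Hence a weakly cartesian `τ` satisfies `supp ∘ τ = supp`.
Conversely, this equation forces `τ` to act as `[x, a] ↦ [x, c]` with `c` depending only on `a`,
which makes lifts explicit. So `τ` is weakly cartesian iff it preserves supports.

If supports are preserved, `τ` changes only coefficients while `distrib` changes only tuples, so
Płonka sums are preserved. For the converse, the index component of a Płonka sum's structure map is
the product of the indices in the support. Over the free commutative monoid on `X`, with the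
constant one-point diagram, this product recovers the support itself. By `supp_η` and `supp_μ` these
test sums are Eilenberg–Moore algebras, so the restricted condition already suffices. -/

theorem card_fiber_eq_count {ι α : Type*} [Fintype ι] [DecidableEq α] (x : ι → α) (c : α)
    [Fintype {j // x j = c}] :
    Fintype.card {j // x j = c} = ((univ : Finset ι).val.map x).count c := by
  rw [Multiset.count_map, Fintype.card_subtype, Finset.card_def, Finset.filter_val]
  simp only [eq_comm]

/-- Fibres over a common value have the same size, its multiplicity; bijections between fibres glue.
-/
theorem exists_equiv_of_map_univ_eq {ι κ α : Type*} [Fintype ι] [Fintype κ] {x : ι → α}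
    {y : κ → α} (h : (univ : Finset ι).val.map x = (univ : Finset κ).val.map y) :
    ∃ σ : ι ≃ κ, x = y ∘ σ := by
  classical
  let e : ∀ c, {j // x j = c} ≃ {j // y j = c} := fun c =>
    Fintype.equivOfCardEq (by rw [card_fiber_eq_count, card_fiber_eq_count, h])
  refine ⟨(Equiv.sigmaFiberEquiv x).symm.trans
    ((Equiv.sigmaCongrRight e).trans (Equiv.sigmaFiberEquiv y)), funext fun j => ?_⟩
  exact (e (x j) ⟨j, rfl⟩).2.symm

theorem exists_fin_family {α : Type*} (s : Multiset α) :
    ∃ (n : ℕ) (x : Fin n → α), s = univ.val.map x := by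
  obtain ⟨l, rfl⟩ := Quot.exists_rep s
  refine ⟨l.length, l.get, ?_⟩
  rw [Fin.univ_val_map, List.ofFn_get]
  rfl

/-- A multiset whose image is the image of a finite family is itself the image of a lift of that
family. -/
theorem exists_lift_of_map_eq {ι α β : Type*} [Fintype ι] {f : α → β} {s : Multiset α}
    {y : ι → β} (h : s.map f = univ.val.map y) :
    ∃ x : ι → α, f ∘ x = y ∧ s = univ.val.map x := by
  obtain ⟨n, w, rfl⟩ := exists_fin_family s
  rw [Multiset.map_map] at h
  obtain ⟨σ, hσ⟩ := exists_equiv_of_map_univ_eq h.symm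
  refine ⟨w ∘ σ, hσ.symm, ?_⟩
  rw [← Multiset.map_map, Multiset.map_univ_val_equiv]

end Multisets

/-! ### Supports -/

theorem WeaklyCartesian.exists_lift {F G : Type u ⥤ Type u} {α : F ⟶ G} (hα : WeaklyCartesian α)
    {X Y : Type u} (f : X ⟶ Y) (v : F.obj Y) (w : G.obj X) (h : α.app Y v = G.map f w) :
    ∃ t : F.obj X, F.map f t = v ∧ α.app X t = w := by
  obtain ⟨l⟩ := hα f
  -- A compatible pair of elements is a cone with vertex a point.
  have hc : homOfElement v ≫ α.app Y = homOfElement w ≫ G.map f :=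
    ConcreteCategory.hom_ext _ _ fun _ => h
  exact ⟨PullbackCone.IsWeakLimit.lift l _ _ hc PUnit.unit,
    ConcreteCategory.congr_hom (PullbackCone.IsWeakLimit.lift_fst l _ _ hc) PUnit.unit,
    ConcreteCategory.congr_hom (PullbackCone.IsWeakLimit.lift_snd l _ _ hc) PUnit.unit⟩

theorem weaklyCartesian_of_exists_lift {F G : Type u ⥤ Type u} {α : F ⟶ G}
    (h : ∀ {X Y : Type u} (f : X ⟶ Y) (v : F.obj Y) (w : G.obj X), α.app Y v = G.map f w →
      ∃ t : F.obj X, F.map f t = v ∧ α.app X t = w) : WeaklyCartesian α := by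
  intro X Y f
  have key : ∀ (s : PullbackCone (α.app Y) (G.map f)) (p : s.pt),
      ∃ t : F.obj X, F.map f t = s.fst p ∧ α.app X t = s.snd p := fun s p =>
    h f _ _ (ConcreteCategory.congr_hom s.condition p)
  choose l hl₁ hl₂ using key
  exact ⟨PullbackCone.IsWeakLimit.mk _ (fun s => ↾(l s))
    (fun s => ConcreteCategory.hom_ext _ _ (hl₁ s))
    (fun s => ConcreteCategory.hom_ext _ _ (hl₂ s))⟩

/-- A weakly cartesian natural transformation from `G` to the finite multiset functor. -/
structure IsSupport (G : Type u ⥤ Type u) (α : ∀ X, G.obj X → Multiset X) : Prop where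
  naturality : ∀ {X Y : Type u} (f : X ⟶ Y) (t : G.obj X), α Y (G.map f t) = (α X t).map f
  exists_lift : ∀ {X Y : Type u} (f : X ⟶ Y) (v : G.obj Y) (s : Multiset X), s.map f = α Y v →
    ∃ t : G.obj X, G.map f t = v ∧ α X t = s

namespace IsSupport

open Finset (univ)

variable {G : Type u ⥤ Type u} {α β : ∀ X, G.obj X → Multiset X}

/-- Enumerate `β M t` by `y` and lift `t` along `y` to an element with full `β`-support. The
`α`-support of the lift is enumerated by a section `z` of `y`. The lift itself comes from `M` along
`z`, so its full `β`-support lies in the image of `z`. Thus `z` is onto and `y` is bijective. -/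
theorem eq_univ_of_eq_univ (hα : IsSupport G α) (hβ : IsSupport G β) {M : Type u} [Fintype M]
    {t : G.obj M} (ht : α M t = univ.val) : β M t = univ.val := by
  obtain ⟨k, y', hy'⟩ := exists_fin_family (β M t)
  let y : ULift.{u} (Fin k) → M := y' ∘ ULift.down
  have hy : univ.val.map y = β M t := by
    rw [hy', ← Multiset.map_map]
    congr 1
    exact Multiset.map_univ_val_equiv Equiv.ulift
  obtain ⟨t₂, rfl, h₂⟩ := hβ.exists_lift (↾y) t univ.val hy
  rw [hα.naturality] at ht
  obtain ⟨z, hyz, hz⟩ := exists_lift_of_map_eq (y := id) (ht.trans (Multiset.map_id _).symm)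
  obtain ⟨t₃, rfl, -⟩ := hα.exists_lift (↾z) t₂ univ.val hz.symm
  rw [hβ.naturality] at h₂
  have hzs : Function.Surjective z := fun i => by
    have hi : i ∈ (β M t₃).map (↾z) := h₂ ▸ Finset.mem_univ i
    obtain ⟨j, -, hj⟩ := Multiset.mem_map.1 hi
    exact ⟨j, hj⟩
  have hyb : Function.Bijective y := by
    refine ⟨fun i j hij => ?_, fun m => ⟨z m, congrFun hyz m⟩⟩
    obtain ⟨i, rfl⟩ := hzs i
    obtain ⟨j, rfl⟩ := hzs j
    exact congrArg z (((congrFun hyz i).symm.trans hij).trans (congrFun hyz j))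
  rw [← hy]
  exact Multiset.map_univ_val_equiv (Equiv.ofBijective y hyb)

/-- A functor has at most one weakly cartesian transformation to the multiset functor. -/
theorem unique (hα : IsSupport G α) (hβ : IsSupport G β) (X : Type u) (t : G.obj X) :
    α X t = β X t := by
  obtain ⟨k, x', hx'⟩ := exists_fin_family (α X t)
  let x : ULift.{u} (Fin k) → X := x' ∘ ULift.down
  have hx : univ.val.map x = α X t := by
    rw [hx', ← Multiset.map_map]
    congr 1
    exact Multiset.map_univ_val_equiv Equiv.ulift
  -- Naturality reduces the claim to `s`, whose `α`-support lists each index exactly once.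
  obtain ⟨s, rfl, hs⟩ := hα.exists_lift (↾x) t univ.val hx
  rw [hα.naturality, hβ.naturality, hs, hα.eq_univ_of_eq_univ hβ hs]

theorem comp {F : Type u ⥤ Type u} {γ : F ⟶ G} (hα : IsSupport G α) (hγ : WeaklyCartesian γ) :
    IsSupport F fun X t => α X (γ.app X t) where
  naturality f t := by
    have h : γ.app _ (F.map f t) = G.map f (γ.app _ t) :=
      ConcreteCategory.congr_hom (γ.naturality f) t
    simp only [h, hα.naturality]
  exists_lift f v s hs := by
    obtain ⟨w, hw, rfl⟩ := hα.exists_lift f _ s hs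
    obtain ⟨t, ht, rfl⟩ := hγ.exists_lift f v w hw.symm
    exact ⟨t, ht, rfl⟩

theorem singleton : IsSupport (𝟭 (Type u)) fun _ x => {x} where
  naturality f x := rfl
  exists_lift f v s hs := by
    obtain ⟨x, rfl, hx⟩ := Multiset.map_eq_singleton.1 hs
    exact ⟨x, hx, rfl⟩

end IsSupport

/-- The multiset of members of `x` for the element `[x, a]` of an analytic functor. -/
def seriesSupp (A : SymmetricSequence.{u}) (X : Type u) (t : A.series.obj X) : Multiset X :=
  Quotient.lift (s := A.tensorSetoid t.1 X) (fun p => Finset.univ.val.map p.1)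
    (by
      rintro ⟨x, a⟩ ⟨y, b⟩ ⟨σ, h₁, h₂⟩
      dsimp only at h₁ ⊢
      rw [h₁, ← Multiset.map_map, Multiset.map_univ_val_equiv])
    t.2

namespace AnalyticMonad

open Finset (univ)

variable (𝒜 : AnalyticMonad.{u}) {X Y : Type u} {n : ℕ}

/-- The multiset of members of `x` for the element `[x, a]`. -/
def supp (X : Type u) (t : 𝒜.toMonad.obj X) : Multiset X :=
  seriesSupp 𝒜.coeff X (𝒜.expansion.hom.app X t)

theorem supp_elt (x : Fin n → X) (a : 𝒜.coeff.obj n) :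
    𝒜.supp X (𝒜.elt x a) = univ.val.map x :=
  congrArg (seriesSupp 𝒜.coeff X) (expansion_elt x a)

theorem exists_elt (t : 𝒜.toMonad.obj X) :
    ∃ (n : ℕ) (x : Fin n → X) (a : 𝒜.coeff.obj n), t = 𝒜.elt x a := by
  have ht : 𝒜.expansion.inv.app X (𝒜.expansion.hom.app X t) = t :=
    ConcreteCategory.congr_hom (𝒜.expansion.hom_inv_id_app X) t
  generalize 𝒜.expansion.hom.app X t = q at ht
  obtain ⟨n, q⟩ := q
  obtain ⟨⟨x, a⟩, rfl⟩ := Quotient.exists_rep q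
  exact ⟨n, x, a, ht.symm⟩

theorem map_elt (f : X ⟶ Y) (x : Fin n → X) (a : 𝒜.coeff.obj n) :
    𝒜.toMonad.map f (𝒜.elt x a) = 𝒜.elt (f ∘ x) a :=
  (ConcreteCategory.congr_hom (𝒜.expansion.inv.naturality f) _).symm

variable {𝒜} in
-- Any enumeration of the support may serve as the tuple: the reordering is absorbed by acting on
-- the coefficient.
theorem exists_elt_eq_of_supp_eq {t : 𝒜.toMonad.obj X} {x : Fin n → X}
    (h : 𝒜.supp X t = univ.val.map x) : ∃ a, t = 𝒜.elt x a := by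
  obtain ⟨m, y, b, rfl⟩ := 𝒜.exists_elt t
  rw [supp_elt] at h
  obtain ⟨σ, rfl⟩ := exists_equiv_of_map_univ_eq h
  obtain rfl : m = n := by simpa using Fintype.card_congr σ
  exact ⟨_, elt_perm x b σ⟩

theorem isSupport_supp : IsSupport 𝒜.toMonad.toFunctor 𝒜.supp where
  naturality f t := by
    obtain ⟨n, x, a, rfl⟩ := 𝒜.exists_elt t
    rw [map_elt, supp_elt, supp_elt, Multiset.map_map]
  exists_lift f v s hs := by
    obtain ⟨n, y, a, rfl⟩ := 𝒜.exists_elt v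
    rw [supp_elt] at hs
    obtain ⟨x, rfl, rfl⟩ := exists_lift_of_map_eq hs
    exact ⟨𝒜.elt x a, 𝒜.map_elt _ _ _, 𝒜.supp_elt _ _⟩

theorem map_bind_supp (f : X ⟶ Y) (s : Multiset (𝒜.toMonad.obj X)) :
    (s.map (𝒜.toMonad.map f)).bind (𝒜.supp Y) = (s.bind (𝒜.supp X)).map f := by
  rw [Multiset.bind_map, Multiset.map_bind]
  exact Multiset.bind_congr fun t _ => 𝒜.isSupport_supp.naturality f t

theorem isSupport_bind_supp : IsSupport (𝒜.toMonad.toFunctor ⋙ 𝒜.toMonad.toFunctor)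
    fun X t => (𝒜.supp _ t).bind (𝒜.supp X) where
  naturality f t := by
    rw [← map_bind_supp, ← 𝒜.isSupport_supp.naturality]
    rfl
  exists_lift {X Y} f v s hs := by
    obtain ⟨n, w, a, rfl⟩ := 𝒜.exists_elt v
    choose k y b hw using fun i => 𝒜.exists_elt (w i)
    obtain rfl : w = fun i => 𝒜.elt (y i) (b i) := funext hw
    -- With the coefficients fixed, a nested element is one family indexed by a sigma type, so
    -- lifting it is lifting that family.
    have hbind : ∀ {W : Type u} (z : ∀ i, Fin (k i) → W),
        (𝒜.supp _ (𝒜.elt (fun i => 𝒜.elt (z i) (b i)) a)).bind (𝒜.supp W) =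
          (univ : Finset (Σ i, Fin (k i))).val.map fun p => z p.1 p.2 := by
      intro W z
      rw [supp_elt, Multiset.bind_map]
      simp only [supp_elt]
      have huniv : (univ : Finset (Σ i, Fin (k i))).val =
          univ.val.bind fun i => univ.val.map (Sigma.mk i) := rfl
      rw [huniv, Multiset.map_bind]
      refine Multiset.bind_congr fun i _ => ?_
      rw [Multiset.map_map]
      rfl
    rw [hbind] at hs
    obtain ⟨x, hx, rfl⟩ := exists_lift_of_map_eq hs
    refine ⟨𝒜.elt (fun i => 𝒜.elt (fun j => x ⟨i, j⟩) (b i)) a, ?_, hbind fun i j => x ⟨i, j⟩⟩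
    change 𝒜.toMonad.map (𝒜.toMonad.map f) _ = _
    rw [map_elt]
    congr 1
    funext i
    simp only [Function.comp_apply, map_elt]
    congr 1
    funext j
    exact congrFun hx ⟨i, j⟩

/-- Together with `supp_μ`, this makes `supp` a morphism to the multiset monad. Weak cartesianness
of the unit and multiplication enters here, through uniqueness of supports. -/
theorem supp_η (x : X) : 𝒜.supp X (𝒜.toMonad.η.app X x) = {x} :=
  (𝒜.isSupport_supp.comp 𝒜.weaklyCartesian_η).unique IsSupport.singleton X x

theorem supp_μ (t : 𝒜.toMonad.obj (𝒜.toMonad.obj X)) :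
    𝒜.supp X (𝒜.toMonad.μ.app X t) = (𝒜.supp _ t).bind (𝒜.supp X) :=
  (𝒜.isSupport_supp.comp 𝒜.weaklyCartesian_μ).unique 𝒜.isSupport_bind_supp X t

end AnalyticMonad

/-! ### Transformations of analytic functors -/

section Transformations

open Finset (univ)

variable {𝒜 𝒜' : AnalyticMonad.{u}}
  {τ : 𝒜.toMonad.toFunctor ⟶ 𝒜'.toMonad.toFunctor}

theorem supp_app_of_weaklyCartesian (hτ : WeaklyCartesian τ) {X : Type u}
    (t : 𝒜.toMonad.obj X) : 𝒜'.supp X (τ.app X t) = 𝒜.supp X t :=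
  (𝒜'.isSupport_supp.comp hτ).unique 𝒜.isSupport_supp X t

/-- A transformation preserving supports acts on coefficients only. -/
theorem exists_coeff_of_supp_app
    (h : ∀ (X : Type u) (t : 𝒜.toMonad.obj X), 𝒜'.supp X (τ.app X t) = 𝒜.supp X t)
    {n : ℕ} (a : 𝒜.coeff.obj n) :
    ∃ c, ∀ {X : Type u} (x : Fin n → X), τ.app X (𝒜.elt x a) = 𝒜'.elt x c := by
  -- The element with distinct entries is generic: every `[x, a]` is its image under `x`.
  have hx := h (ULift (Fin n)) (𝒜.elt ULift.up a)
  rw [𝒜.supp_elt] at hx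
  obtain ⟨c, hc⟩ := AnalyticMonad.exists_elt_eq_of_supp_eq hx
  refine ⟨c, fun {X} x => ?_⟩
  have hnat : τ.app X (𝒜.toMonad.map (↾(x ∘ ULift.down)) (𝒜.elt ULift.up a)) =
      𝒜'.toMonad.map (↾(x ∘ ULift.down)) (τ.app _ (𝒜.elt ULift.up a)) :=
    ConcreteCategory.congr_hom (τ.naturality (↾(x ∘ ULift.down))) _
  rw [hc, 𝒜.map_elt, 𝒜'.map_elt] at hnat
  exact hnat

theorem weaklyCartesian_of_supp_app
    (h : ∀ (X : Type u) (t : 𝒜.toMonad.obj X), 𝒜'.supp X (τ.app X t) = 𝒜.supp X t) :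
    WeaklyCartesian τ := by
  refine weaklyCartesian_of_exists_lift fun {X Y} f v w hvw => ?_
  obtain ⟨n, x, c, rfl⟩ := 𝒜'.exists_elt w
  rw [show 𝒜'.toMonad.toFunctor.map f _ = _ from 𝒜'.map_elt f x c] at hvw
  have hv := h Y v
  rw [hvw, 𝒜'.supp_elt] at hv
  obtain ⟨a, rfl⟩ := AnalyticMonad.exists_elt_eq_of_supp_eq hv.symm
  obtain ⟨d, hd⟩ := exists_coeff_of_supp_app h a
  rw [hd] at hvw
  have hq := congrArg (𝒜'.expansion.hom.app Y) hvw
  rw [AnalyticMonad.expansion_elt, AnalyticMonad.expansion_elt] at hq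
  obtain ⟨σ, hσ, rfl⟩ := Quotient.exact (eq_of_heq (Sigma.mk.inj hq).2)
  dsimp only at hσ
  -- Here `σ` fixes `f ∘ x` but perhaps not `x`. Hence the lift uses `x ∘ σ`: its image under `f` is
  -- unchanged, and `τ` turns the permutation into the required coefficient `σ • d`.
  refine ⟨𝒜.elt (x ∘ σ) a, (𝒜.map_elt _ _ _).trans ?_, (hd _).trans ?_⟩
  · rw [← Function.comp_assoc, ← hσ]
  · rw [AnalyticMonad.elt_perm]

end Transformations

/-! ### Preservation of Płonka sums -/

section Preservation

variable {𝒜 𝒜' : AnalyticMonad.{u}}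

theorem preservesPlonkaSums_of_weaklyCartesian {τ : 𝒜.toMonad ⟶ 𝒜'.toMonad}
    (hτ : WeaklyCartesian τ.toNatTrans) : PreservesPlonkaSums τ := by
  intro Z _ F
  apply ConcreteCategory.hom_ext
  intro t
  obtain ⟨n, x, a, rfl⟩ := 𝒜.exists_elt t
  obtain ⟨c, hc⟩ := exists_coeff_of_supp_app (fun _ => supp_app_of_weaklyCartesian hτ) a
  rw [types_comp_apply, hc]
  refine (plonkaStr_elt 𝒜' F x c).trans ?_
  refine Eq.trans ?_ (plonkaStr_elt 𝒜 (F ⋙ Monad.algebraFunctorOfMonadHom τ) x a).symm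
  -- The same `c` serves for `x` and for its transport into a single fibre.
  exact congrArg (fun r => (⟨∏ j, (x j).1, (F.obj (∏ j, (x j).1)).a r⟩ :
    Coprod (F ⋙ 𝒜'.toMonad.forget))) (hc _).symm

theorem algebra_mk_eq_iff {T : Monad (Type u)} {A : Type u} {a b : T.obj A ⟶ A} {h₁ h₂ h₃ h₄} :
    (⟨A, a, h₁, h₂⟩ : T.Algebra) = ⟨A, b, h₃, h₄⟩ ↔ a = b := by
  simp

theorem PreservesPlonkaSums.preservesPlonkaAlgebras {τ : 𝒜.toMonad ⟶ 𝒜'.toMonad}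
    (hτ : PreservesPlonkaSums τ) : PreservesPlonkaAlgebras τ := by
  intro Z _ F h' h
  exact algebra_mk_eq_iff.2 (hτ Z F)

theorem plonkaStr_fst {Z : Type u} [CommMonoid Z] (F : LinPoly Z ⥤ 𝒜.toMonad.Algebra)
    (t : 𝒜.toMonad.obj (Coprod (F ⋙ 𝒜.toMonad.forget))) :
    (plonkaStr 𝒜 F t).1 = ((𝒜.supp _ t).map Sigma.fst).prod := by
  obtain ⟨n, x, a, rfl⟩ := 𝒜.exists_elt t
  rw [plonkaStr_elt, 𝒜.supp_elt, Multiset.map_map]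
  rfl

/-- With fibres of at most one element only indices matter, and there the axioms say that products
of multisets respect singletons and unions. -/
theorem hasPlonkaAlgebra_of_subsingleton {Z : Type u} [CommMonoid Z]
    (F : LinPoly Z ⥤ 𝒜.toMonad.Algebra) (hF : ∀ z, Subsingleton (F.obj z).A) :
    HasPlonkaAlgebra 𝒜 F := by
  have hext : ∀ {p q : Coprod (F ⋙ 𝒜.toMonad.forget)}, p.1 = q.1 → p = q := by
    rintro ⟨z, p⟩ ⟨_, q⟩ rfl
    exact congrArg (Sigma.mk z) ((hF z).elim p q)
  constructor
  · apply ConcreteCategory.hom_ext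
    intro x
    apply hext
    rw [types_comp_apply, plonkaStr_fst, AnalyticMonad.supp_η]
    simp
  · apply ConcreteCategory.hom_ext
    intro t
    apply hext
    rw [types_comp_apply, types_comp_apply, plonkaStr_fst, plonkaStr_fst, AnalyticMonad.supp_μ,
      show 𝒜.supp _ (𝒜.toMonad.map (plonkaStr 𝒜 F) t) = _ from
        𝒜.isSupport_supp.naturality (plonkaStr 𝒜 F) t, Multiset.map_bind, Multiset.prod_bind,
      Multiset.map_map]
    exact congrArg Multiset.prod (Multiset.map_congr rfl fun s _ => (plonkaStr_fst F s).symm)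

/-- The algebra on a one-element set. -/
def unitAlgebra (T : Monad (Type u)) : T.Algebra where
  A := PUnit
  a := ↾fun _ => PUnit.unit
  unit := ConcreteCategory.hom_ext _ _ fun _ => rfl
  assoc := ConcreteCategory.hom_ext _ _ fun _ => rfl

theorem PreservesPlonkaAlgebras.weaklyCartesian {τ : 𝒜.toMonad ⟶ 𝒜'.toMonad}
    (hτ : PreservesPlonkaAlgebras τ) : WeaklyCartesian τ.toNatTrans := by
  refine weaklyCartesian_of_supp_app fun X t => ?_
  -- The free commutative monoid on `X`: a product of generators remembers the multiset of its
  -- factors.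
  let Z : Type u := Multiplicative (Multiset X)
  let F : LinPoly Z ⥤ 𝒜'.toMonad.Algebra := (Functor.const _).obj (unitAlgebra 𝒜'.toMonad)
  have hF : ∀ z, Subsingleton (F.obj z).A := fun _ => inferInstanceAs (Subsingleton PUnit)
  have hstr := algebra_mk_eq_iff.1 (hτ Z F (hasPlonkaAlgebra_of_subsingleton F hF)
    (hasPlonkaAlgebra_of_subsingleton (F ⋙ Monad.algebraFunctorOfMonadHom τ) hF))
  let g : X ⟶ Coprod (F ⋙ 𝒜'.toMonad.forget) :=
    ↾fun x => ⟨(Multiplicative.ofAdd {x} : Multiplicative (Multiset X)), PUnit.unit⟩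
  have hprod : ∀ s : Multiset X, ((s.map g).map Sigma.fst).prod = Multiplicative.ofAdd s := by
    intro s
    rw [Multiset.map_map]
    exact Multiset.sum_map_singleton s
  have hg := congrArg Sigma.fst (ConcreteCategory.congr_hom hstr (𝒜.toMonad.map g t))
  have hnat : τ.app _ (𝒜.toMonad.map g t) = 𝒜'.toMonad.map g (τ.app X t) :=
    ConcreteCategory.congr_hom (τ.naturality g) t
  have h₁ : (plonkaStr 𝒜' F (τ.app _ (𝒜.toMonad.map g t))).1 = 𝒜'.supp X (τ.app X t) := by
    rw [hnat, plonkaStr_fst]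
    exact (congrArg (fun s => (Multiset.map Sigma.fst s).prod)
      (𝒜'.isSupport_supp.naturality g (τ.app X t))).trans (hprod _)
  have h₂ : (plonkaStr 𝒜 (F ⋙ Monad.algebraFunctorOfMonadHom τ) (𝒜.toMonad.map g t)).1 =
      𝒜.supp X t :=
    (plonkaStr_fst _ _).trans ((congrArg (fun s => (Multiset.map Sigma.fst s).prod)
      (𝒜.isSupport_supp.naturality g t)).trans (hprod _))
  exact h₁.symm.trans (hg.trans h₂)

end Preservation

end Plonka

theorem mainTheorem2 (𝒜 𝒜' : Plonka.AnalyticMonad.{u}) (τ : 𝒜.toMonad ⟶ 𝒜'.toMonad) :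
    (Plonka.WeaklyCartesian τ.toNatTrans ↔ Plonka.PreservesPlonkaSums τ) ∧
    (Plonka.WeaklyCartesian τ.toNatTrans ↔ Plonka.PreservesPlonkaAlgebras τ) :=
  ⟨⟨Plonka.preservesPlonkaSums_of_weaklyCartesian,
      fun h => h.preservesPlonkaAlgebras.weaklyCartesian⟩,
    ⟨fun h => (Plonka.preservesPlonkaSums_of_weaklyCartesian h).preservesPlonkaAlgebras,
      fun h => h.weaklyCartesian⟩⟩
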